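/- Let $H$ be a Heyting algebra. A \emph{Heyting module} over $H$ is a join semilattice $M$ with least element $0$ and an action $H\times M\to M$, $(x,m)\mapsto x\wedge m$, order preserving in both variables, such that $1\wedge m=m$, $0\wedge m=0$, $(x\wedge y)\wedge m=x\wedge(y\wedge m)$, $(x\vee y)\wedge m=(x\wedge m)\vee(y\wedge m)$ and $x\wedge(m\vee n)=(x\wedge m)\vee(x\wedge n)$ for all $x,y\in H$ and $m,n\in M$, and such that for all $m,n\in M$ there is an element $(m\to n)_M\in H$ with $x\wedge m\le n\iff x\le (m\to n)_M$ for every $x\in H$. A \emph{Heyting submodule} of $M$ is a subset $N\subseteq M$ that contains $0$ and is closed under binary joins and under the action of $H$. Let $Sub(M)$ be the set of Heyting submodules of $M$, and for every finite family $m_1,\dots,m_n$ of elements of $M$ put $$D(m_1,\dots,m_n)=\{N\in Sub(M)\mid m_i\notin N\text{ for some } i\}.$$ Equip $Sub(M)$ with the topology that has the sets $D(m_1,\dots,m_n)$ as a subbasis of open sets. \textbf{Proposition.} For every Heyting algebra $H$ and every Heyting module $M$ over $H$, the space $Sub(M)$ is spectral, that is, it is quasi-compact, its quasi-compact open subsets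 are closed under binary intersection and form a basis of the topology, and every non-empty irreducible closed subset has a unique generic point. Moreover the sets $D(m_1,\dots,m_n)$ form a subbasis of the topology of $Sub(M)$ consisting of quasi-compact open sets. -/

import Mathlib

universe u v

/-- A module over a (bounded) distributive lattice `L`: a join semilattice `M` with a least element,
with an action of `L` that is order preserving in both variables and satisfies
`1 ∧ m = m`, `0 ∧ m = 0` and `(x ∧ y) ∧ m = x ∧ (y ∧ m)`. The action is written `x • m`. -/
class LatticeModule (L : Type u) (M : Type v) [DistribLattice L] [BoundedOrder L]
    [SemilatticeSup M] [OrderBot M] extends SMul L M where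
  smul_le_smul : ∀ {x y : L} {m n : M}, x ≤ y → m ≤ n → x • m ≤ y • n
  top_smul : ∀ m : M, (⊤ : L) • m = m
  bot_smul : ∀ m : M, (⊥ : L) • m = ⊥
  inf_smul : ∀ (x y : L) (m : M), (x ⊓ y) • m = x • (y • m)

/-- A distributive module over a distributive lattice: the action preserves binary joins in each
variable. -/
class DistribLatticeModule (L : Type u) (M : Type v) [DistribLattice L] [BoundedOrder L]
    [SemilatticeSup M] [OrderBot M] extends LatticeModule L M where
  sup_smul : ∀ (x y : L) (m : M), (x ⊔ y) • m = x • m ⊔ y • m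
  smul_sup : ∀ (x : L) (m n : M), x • (m ⊔ n) = x • m ⊔ x • n

/-- A Heyting module over a Heyting algebra `H`: a distributive module over the lattice underlying
`H` such that, for each `m : M`, the monotone map `x ↦ x • m` from `H` to `M` has a right adjoint
`n ↦ imp m n`. -/
class HeytingModule (H : Type u) (M : Type v) [HeytingAlgebra H]
    [SemilatticeSup M] [OrderBot M] extends DistribLatticeModule H M where
  imp : M → M → H
  gc : ∀ m : M, GaloisConnection (fun x : H => x • m) (fun n : M => imp m n)

/-- A Heyting submodule of `M`: a subset closed under finite joins (the empty join `⊥` included)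
and under the action of `H`. -/
structure HeytingSubmodule (H : Type u) (M : Type v) [HeytingAlgebra H]
    [SemilatticeSup M] [OrderBot M] [HeytingModule H M] where
  carrier : Set M
  bot_mem : ⊥ ∈ carrier
  sup_mem : ∀ {m n : M}, m ∈ carrier → n ∈ carrier → m ⊔ n ∈ carrier
  smul_mem : ∀ (x : H) {m : M}, m ∈ carrier → x • m ∈ carrier

namespace HeytingSubmodule

variable (H : Type u) {M : Type v} [HeytingAlgebra H] [SemilatticeSup M] [OrderBot M]
  [HeytingModule H M]

instance : SetLike (HeytingSubmodule H M) M where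
  coe N := N.carrier
  coe_injective N N' h := by
    cases N
    cases N'
    congr

/-- `V(m₁, …, mₙ)`: the submodules that contain all of `m₁, …, mₙ`. -/
def V {n : ℕ} (m : Fin n → M) : Set (HeytingSubmodule H M) :=
  {N | ∀ i, m i ∈ N}

/-- `D(m₁, …, mₙ)`: the submodules that do not contain all of `m₁, …, mₙ`. -/
def D {n : ℕ} (m : Fin n → M) : Set (HeytingSubmodule H M) :=
  (V H m)ᶜ

variable (M)

/-- The collection of all the sets `D(m₁, …, mₙ)`. -/
def subbasis : Set (Set (HeytingSubmodule H M)) :=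
  {U | ∃ (n : ℕ) (m : Fin n → M), U = D H m}

/-- The topology on the set of Heyting submodules with the sets `D(m₁, …, mₙ)` as an open
subbasis. -/
instance : TopologicalSpace (HeytingSubmodule H M) :=
  TopologicalSpace.generateFrom (subbasis H M)

end HeytingSubmodule

open Topology

namespace HeytingSubmodule

section Spectral

variable (H : Type u) {M : Type v} [HeytingAlgebra H] [SemilatticeSup M] [OrderBot M]
  [HeytingModule H M]

/-! Being a submodule is a finitary closure condition, so the elements lying in almost all members
of a filter of submodules again form a submodule, `limit`. An ultrafilter converges to its `limit`,
which makes every `avoiding` set compact; those with finite `s` form a basis closed under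
intersection. The generic point of an irreducible closed `Z` is the `limit` along its principal
filter, the intersection of its members; T0 makes it unique. -/

/-- The submodules that contain no element of `s`. -/
def avoiding (s : Set M) : Set (HeytingSubmodule H M) :=
  {N | ∀ m ∈ s, m ∉ N}

variable {H}

theorem mem_avoiding {s : Set M} {N : HeytingSubmodule H M} :
    N ∈ avoiding H s ↔ ∀ m ∈ s, m ∉ N :=
  Iff.rfl

theorem avoiding_union (s t : Set M) :
    avoiding H (s ∪ t) = avoiding H s ∩ avoiding H t := by
  ext N
  simp only [mem_avoiding, Set.mem_inter_iff, Set.mem_union, or_imp, forall_and]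

theorem D_eq_iUnion_avoiding {n : ℕ} (m : Fin n → M) :
    D H m = ⋃ i, avoiding H {m i} := by
  ext N
  simp [D, V, mem_avoiding]

theorem isOpen_D {n : ℕ} (m : Fin n → M) : IsOpen (D H m) :=
  TopologicalSpace.isOpen_generateFrom_of_mem ⟨n, m, rfl⟩

theorem isOpen_setOf_notMem (m : M) : IsOpen {N : HeytingSubmodule H M | m ∉ N} := by
  have h : {N : HeytingSubmodule H M | m ∉ N} = D H ![m] := by
    ext N
    simp [D, V]
  exact h ▸ isOpen_D _

theorem isOpen_avoiding {s : Set M} (hs : s.Finite) : IsOpen (avoiding H s) := by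
  have h : avoiding H s = ⋂ m ∈ s, {N : HeytingSubmodule H M | m ∉ N} := by
    ext N
    simp [mem_avoiding]
  exact h ▸ hs.isOpen_biInter fun m _ ↦ isOpen_setOf_notMem m

theorem isTopologicalBasis_avoiding :
    TopologicalSpace.IsTopologicalBasis
      (Set.range fun s : Finset M ↦ avoiding H (s : Set M)) := by
  classical
  refine ⟨?_, ?_, le_antisymm ?_ ?_⟩
  · rintro _ ⟨s, rfl⟩ _ ⟨t, rfl⟩ N hN
    refine ⟨_, ⟨s ∪ t, rfl⟩, ?_⟩
    simpa only [Finset.coe_union, avoiding_union] using ⟨hN, subset_rfl⟩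
  · exact Set.eq_univ_of_forall fun N ↦ ⟨_, ⟨∅, rfl⟩, by simp [mem_avoiding]⟩
  · refine le_generateFrom ?_
    rintro _ ⟨s, rfl⟩
    exact isOpen_avoiding s.finite_toSet
  · refine le_generateFrom ?_
    rintro _ ⟨n, m, rfl⟩
    rw [D_eq_iUnion_avoiding]
    -- The topology here is the one generated by the `avoiding` sets, not the instance.
    exact @isOpen_iUnion _ _ (_) _ fun i ↦
      TopologicalSpace.isOpen_generateFrom_of_mem ⟨{m i}, by simp⟩

/-- The submodule of the elements that lie in almost all submodules along a filter. -/
def limit (F : Filter (HeytingSubmodule H M)) : HeytingSubmodule H M where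
  carrier := {m | ∀ᶠ N in F, m ∈ N}
  bot_mem := Filter.Eventually.of_forall fun N ↦ N.bot_mem
  sup_mem hm hn := by
    filter_upwards [hm, hn] with N hm hn using N.sup_mem hm hn
  smul_mem x _ hm := by
    filter_upwards [hm] with N hm using N.smul_mem x hm

theorem mem_limit {F : Filter (HeytingSubmodule H M)} {m : M} :
    m ∈ limit F ↔ ∀ᶠ N in F, m ∈ N :=
  Iff.rfl

/-- For an ultrafilter, an element outside the limit is omitted by almost all submodules; finiteness
of `s` allows this for all its elements at once. -/
theorem ultrafilter_le_nhds_limit (F : Ultrafilter (HeytingSubmodule H M)) :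
    (F : Filter (HeytingSubmodule H M)) ≤ 𝓝 (limit (F : Filter (HeytingSubmodule H M))) := by
  refine (isTopologicalBasis_avoiding.nhds_hasBasis).ge_iff.2 ?_
  rintro _ ⟨⟨s, rfl⟩, hs⟩
  have h : ∀ᶠ N in (F : Filter (HeytingSubmodule H M)), ∀ m ∈ s, m ∉ N :=
    (Filter.eventually_all_finset s).2 fun m hm ↦
      Ultrafilter.eventually_not.2 (hs m hm)
  exact h

/-- An element of `s` in the limit would lie in almost all submodules, yet almost all avoid `s`. No
finiteness of `s` is needed. -/
theorem isCompact_avoiding (s : Set M) : IsCompact (avoiding H s) := by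
  refine isCompact_iff_ultrafilter_le_nhds.2 fun F hF ↦ ⟨limit F, ?_, ultrafilter_le_nhds_limit F⟩
  intro m hm
  refine Ultrafilter.eventually_not.1 ?_
  filter_upwards [Filter.le_principal_iff.1 hF] with N hN using hN m hm

theorem isCompact_D {n : ℕ} (m : Fin n → M) : IsCompact (D H m) := by
  rw [D_eq_iUnion_avoiding]
  exact isCompact_iUnion fun i ↦ isCompact_avoiding _

instance : CompactSpace (HeytingSubmodule H M) where
  isCompact_univ := by
    simpa [avoiding] using isCompact_avoiding (H := H) (∅ : Set M)

instance : T0Space (HeytingSubmodule H M) where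
  t0 _ _ h := SetLike.ext fun m ↦
    not_iff_not.1 (h.mem_open_iff (isOpen_setOf_notMem m))

instance : PrespectralSpace (HeytingSubmodule H M) :=
  .of_isTopologicalBasis isTopologicalBasis_avoiding <| by
    rintro _ ⟨s, rfl⟩
    exact isCompact_avoiding _

instance : QuasiSeparatedSpace (HeytingSubmodule H M) :=
  .of_isTopologicalBasis isTopologicalBasis_avoiding fun s t ↦ by
    rw [← avoiding_union]
    exact isCompact_avoiding _

/-- Irreducibility merges the separate witnesses `N` into a single one; this puts the intersection
of `Z` in the closure of `Z`. -/
theorem exists_mem_avoiding_of_isIrreducible {Z : Set (HeytingSubmodule H M)}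
    (hZ : IsIrreducible Z) (s : Finset M) (hs : ∀ m ∈ s, ∃ N ∈ Z, m ∉ N) :
    (Z ∩ avoiding H (s : Set M)).Nonempty := by
  classical
  induction s using Finset.induction_on with
  | empty => simpa [avoiding] using hZ.nonempty
  | insert m s _ ih =>
    rw [Finset.coe_insert, Set.insert_eq, avoiding_union]
    refine hZ.2 _ _ (isOpen_avoiding (Set.finite_singleton m)) (isOpen_avoiding s.finite_toSet) ?_
      (ih fun n hn ↦ hs n (Finset.mem_insert_of_mem hn))
    obtain ⟨N, hN, hm⟩ := hs m (Finset.mem_insert_self m s)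
    exact ⟨N, hN, by simpa [mem_avoiding] using hm⟩

instance : QuasiSober (HeytingSubmodule H M) where
  sober {Z} hZ hZc := by
    -- The generic point is the intersection of all the submodules in `Z`.
    have hmem {m : M} : m ∈ limit (Filter.principal Z) ↔ ∀ N ∈ Z, m ∈ N := by
      rw [mem_limit, Filter.eventually_principal]
    refine ⟨limit (Filter.principal Z), Set.Subset.antisymm ?_ fun N hN ↦ ?_⟩
    · refine closure_minimal (Set.singleton_subset_iff.2 ?_) hZc
      refine hZc.closure_subset (isTopologicalBasis_avoiding.mem_closure_iff.2 ?_)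
      rintro _ ⟨s, rfl⟩ hs
      rw [Set.inter_comm]
      refine exists_mem_avoiding_of_isIrreducible hZ s fun m hm ↦ ?_
      simpa only [hmem, not_forall, exists_prop] using hs m hm
    · rw [isTopologicalBasis_avoiding.mem_closure_iff]
      rintro _ ⟨s, rfl⟩ hs
      -- The intersection is contained in `N`, so it avoids whatever `N` avoids.
      exact ⟨_, fun m hm h ↦ hs m hm (hmem.1 h N hN), rfl⟩

instance : SpectralSpace (HeytingSubmodule H M) where

end Spectral

end HeytingSubmodule

theorem mainTheorem3 (H : Type u) (M : Type v) [HeytingAlgebra H] [SemilatticeSup M] [OrderBot M]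
    [HeytingModule H M] :
    SpectralSpace (HeytingSubmodule H M) ∧
      (inferInstance : TopologicalSpace (HeytingSubmodule H M)) =
        TopologicalSpace.generateFrom (HeytingSubmodule.subbasis H M) ∧
      ∀ U ∈ HeytingSubmodule.subbasis H M, IsOpen U ∧ IsCompact U := by
  refine ⟨inferInstance, rfl, ?_⟩
  rintro _ ⟨n, m, rfl⟩
  exact ⟨HeytingSubmodule.isOpen_D m, HeytingSubmodule.isCompact_D m⟩
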